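/- Let $n\ge 1$, $s\in(0,1)$, and let $\Omega\subset\mathbb R^n$ be a bounded open set (no regularity of $\partial\Omega$ is needed; this includes bounded $C^{1,1}$ domains). Functions take values in $\mathbb K=\mathbb R$ or $\mathbb K=\mathbb C$. Let $H^s(\mathbb R^n)$ be the space of $u\in L^2(\mathbb R^n)$ with $\iint_{\mathbb R^n\times\mathbb R^n}\frac{|u(x)-u(y)|^2}{|x-y|^{n+2s}}\,dx\,dy<\infty$, and let $H^s_0(\Omega)$ be the space of $u\in H^s(\mathbb R^n)$ with $u=0$ a.e. in $\mathbb R^n\setminus\Omega$. For $\lambda\in\mathbb K$, a function $u\in H^s_0(\Omega)$ is a solution of $(-\Delta)^su-\lambda u=f$ in $\Omega$, $u=0$ in $\mathbb R^n\setminus\Omega$, if for all $v\in H^s_0(\Omega)$ $$\frac{c_{n,s}}2\iint_{\mathbb R^n\times\mathbb R^n}\frac{(u(x)-u(y))\,\overline{(v(x)-v(y))}}{|x-y|^{n+2s}}\,dx\,dy-\lambda\int_\Omega u\bar v\,dx=\int_\Omega f\bar v\,dx,\qquad c_{n,s}=\frac{s\,2^{2s}\,\Gamma\left(\frac{n+2s}2\right)}{\pi^{n/2}\,\Gamma(1-s)}.$$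 **Theorem.** Let $p\in(1,\infty]$ with $p>\frac n{2s}$, let $\lambda\in\mathbb K$, and let $f=f_1+f_2$ with $f_1\in L^p(\Omega)$ and $f_2\in L^\infty(\Omega)$. If $u\in H^s_0(\Omega)$ is a solution of $(-\Delta)^su-\lambda u=f$ in $\Omega$, $u=0$ in $\mathbb R^n\setminus\Omega$, then $u\in L^\infty(\Omega)$. In particular, every eigenfunction of the fractional Laplacian on $\Omega$, that is, every $u\in H^s_0(\Omega)$ with $u\neq0$ that solves $(-\Delta)^su=\lambda u$ in $\Omega$, $u=0$ in $\mathbb R^n\setminus\Omega$, for some $\lambda\in\mathbb K$, belongs to $L^\infty(\Omega)$. -/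

import Mathlib

open MeasureTheory
open scoped ENNReal

noncomputable section

/-- The normalization constant
`c_{n,s} = s 2^{2s} Γ((n + 2s)/2) / (π^{n/2} Γ(1 - s))` of the fractional Laplacian on `ℝⁿ`. -/
def fracLaplacianConst (n : ℕ) (s : ℝ) : ℝ :=
  s * (2 : ℝ) ^ (2 * s) * Real.Gamma (((n : ℝ) + 2 * s) / 2) /
    (Real.pi ^ ((n : ℝ) / 2) * Real.Gamma (1 - s))

/-- `u ∈ H^s(ℝⁿ)`: `u` is square integrable and its Gagliardo energy
`∬ |u(x) - u(y)|² / |x - y|^{n + 2s} dx dy` is finite. -/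
def MemHs {𝕜 : Type*} [RCLike 𝕜] {n : ℕ} (s : ℝ) (u : EuclideanSpace ℝ (Fin n) → 𝕜) : Prop :=
  MemLp u 2 volume ∧
    Integrable
      (fun z : EuclideanSpace ℝ (Fin n) × EuclideanSpace ℝ (Fin n) =>
        ‖u z.1 - u z.2‖ ^ 2 / ‖z.1 - z.2‖ ^ ((n : ℝ) + 2 * s))
      (volume.prod volume)

/-- `u ∈ H^s_0(Ω)`: `u ∈ H^s(ℝⁿ)` and `u = 0` almost everywhere outside `Ω`. -/
def MemHsZero {𝕜 : Type*} [RCLike 𝕜] {n : ℕ} (s : ℝ) (Ω : Set (EuclideanSpace ℝ (Fin n)))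
    (u : EuclideanSpace ℝ (Fin n) → 𝕜) : Prop :=
  MemHs s u ∧ ∀ᵐ x, x ∉ Ω → u x = 0

/-- The sesquilinear form of the fractional Laplacian on `H^s(ℝⁿ)`,
`⟨(-Δ)^s u, v⟩ = (c_{n,s}/2) ∬ (u(x) - u(y)) conj(v(x) - v(y)) / |x - y|^{n + 2s} dx dy`. -/
def fracLaplacianForm {𝕜 : Type*} [RCLike 𝕜] {n : ℕ} (s : ℝ)
    (u v : EuclideanSpace ℝ (Fin n) → 𝕜) : 𝕜 :=
  ((fracLaplacianConst n s / 2 : ℝ) : 𝕜) *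
    ∫ z : EuclideanSpace ℝ (Fin n) × EuclideanSpace ℝ (Fin n),
      (u z.1 - u z.2) * (starRingEnd 𝕜) (v z.1 - v z.2) /
        ((‖z.1 - z.2‖ ^ ((n : ℝ) + 2 * s) : ℝ) : 𝕜) ∂(volume.prod volume)

/-- `u` is a (weak) solution in `H^s_0(Ω)` of `(-Δ)^s u - μ u = f` in `Ω`, `u = 0` outside `Ω`:
the equation holds when tested against every `v ∈ H^s_0(Ω)`. -/
def IsFracWeakSolution {𝕜 : Type*} [RCLike 𝕜] {n : ℕ} (s : ℝ)
    (Ω : Set (EuclideanSpace ℝ (Fin n))) (μ : 𝕜) (f u : EuclideanSpace ℝ (Fin n) → 𝕜) : Prop :=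
  MemHsZero s Ω u ∧
    ∀ v : EuclideanSpace ℝ (Fin n) → 𝕜, MemHsZero s Ω v →
      fracLaplacianForm s u v - μ * ∫ x in Ω, u x * (starRingEnd 𝕜) (v x) =
        ∫ x in Ω, f x * (starRingEnd 𝕜) (v x)

/-- `u` is an eigenfunction, for the eigenvalue `μ`, of the fractional Laplacian on `Ω` with the
exterior condition `u = 0` outside `Ω`. -/
def IsFracEigenfunction {𝕜 : Type*} [RCLike 𝕜] {n : ℕ} (s : ℝ)
    (Ω : Set (EuclideanSpace ℝ (Fin n))) (μ : 𝕜) (u : EuclideanSpace ℝ (Fin n) → 𝕜) : Prop :=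
  ¬ u =ᵐ[volume] 0 ∧
    MemHsZero s Ω u ∧
    ∀ v : EuclideanSpace ℝ (Fin n) → 𝕜, MemHsZero s Ω v →
      fracLaplacianForm s u v = μ * ∫ x in Ω, u x * (starRingEnd 𝕜) (v x)

/-- `f ∈ L^p(Ω) + L^∞(Ω)`. -/
def MemLpAddLinfty {𝕜 : Type*} [RCLike 𝕜] {n : ℕ} (p : ℝ≥0∞)
    (Ω : Set (EuclideanSpace ℝ (Fin n))) (f : EuclideanSpace ℝ (Fin n) → 𝕜) : Prop :=
  ∃ f₁ f₂ : EuclideanSpace ℝ (Fin n) → 𝕜,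
    MemLp f₁ p (volume.restrict Ω) ∧ MemLp f₂ ∞ (volume.restrict Ω) ∧
      f =ᵐ[volume.restrict Ω] f₁ + f₂

end

/-!
The proof is Stampacchia's truncation method. Write `A_k = {‖u‖ > k}`, and let `v` be the part of
`u` between the levels `k` and `k + h`, that is, `v = min ((‖u‖ - k)⁺, h) u / ‖u‖`. The map `u ↦ v`
is firmly nonexpansive on `𝕜` (`norm_radialTrunc_sub_sq_le`), which covers real and complex values
at once: `v` is an admissible test function, and the real part of the form at `(u, v)` bounds the
Gagliardo energy of `v` (`energy_radialTrunc_le_re_fracLaplacianForm`).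

The full fractional Sobolev inequality is not needed. Since `v` is bounded by `h` and vanishes off
`A_k`, it is enough to bound `∫ ‖v‖²` by a constant times `|A_k|^{2s/n}` times the energy of `v`
(`exists_integral_norm_sq_le_energy`). The weak formulation then gives (`exists_level_estimate`)
`h |A_{k+h}| ≤ C |A_k|^{2s/n} (∫_{A_k} ‖f‖ + |μ| ∫_{A_k} ‖u‖)`.

For `f ∈ L^p` the exponent `ε = 2s/n - 1/p` is positive. If `u ∈ L^r`, the estimate with `h = k`
bounds `|A_{2k}|` by a constant times `k^{-r(1+ε)}`, hence `u ∈ L^{r(1+ε/2)}`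
(`MemLp.exponent_improve_of_level_estimate`). Starting from `r = 2`, finitely many steps give
`u ∈ L^p`. Then both integrals are at most a constant times `|A_k|^{1-1/p}`, so
`h |A_{k+h}| ≤ C' |A_k|^{1+ε}`, and Stampacchia's lemma (`exists_eq_zero_of_mul_le_rpow`) yields a
level `d` with `|A_d| = 0` (`memLp_top_of_level_estimate`).
-/

/-! ### Radial truncation -/

/-- The piece of the nonnegative number `a` that lies between the levels `k` and `k + h`. -/
noncomputable def levelPiece (k h a : ℝ) : ℝ := min (max (a - k) 0) h

/-- The radial truncation `z ↦ min ((‖z‖ - k)⁺, h) z / ‖z‖`; its value at `0` is `0`. -/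
noncomputable def radialTrunc {𝕜 : Type*} [RCLike 𝕜] (k h : ℝ) (z : 𝕜) : 𝕜 :=
  ((levelPiece k h ‖z‖ / ‖z‖ : ℝ) : 𝕜) * z

lemma levelPiece_nonneg {k h : ℝ} (hh : 0 ≤ h) (a : ℝ) : 0 ≤ levelPiece k h a :=
  le_min (le_max_right _ _) hh

lemma levelPiece_le {k h a : ℝ} (hk : 0 ≤ k) (ha : 0 ≤ a) : levelPiece k h a ≤ a :=
  (min_le_left _ _).trans (max_le (by linarith) ha)

lemma levelPiece_le_height (k h a : ℝ) : levelPiece k h a ≤ h := min_le_right _ _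

lemma levelPiece_of_le {k h a : ℝ} (hh : 0 ≤ h) (ha : a ≤ k) : levelPiece k h a = 0 := by
  rw [levelPiece, max_eq_right (by linarith), min_eq_left hh]

lemma levelPiece_of_ge {k h a : ℝ} (ha : k + h ≤ a) : levelPiece k h a = h :=
  min_eq_right (le_max_of_le_left (by linarith))

lemma levelPiece_mono {k h : ℝ} : Monotone (levelPiece k h) := fun a b hab =>
  min_le_min_right _ (max_le_max_right _ (by linarith))

lemma levelPiece_sub_le {k h a b : ℝ} (hab : a ≤ b) :
    levelPiece k h b - levelPiece k h a ≤ b - a := by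
  unfold levelPiece
  rcases le_total (a - k) 0 with h1 | h1 <;> rcases le_total (b - k) 0 with h2 | h2 <;>
    simp only [max_eq_left, max_eq_right, h1, h2] <;>
    rcases min_cases (b - k) h with h3 | h3 <;> rcases min_cases (a - k) h with h4 | h4 <;>
    rcases min_cases 0 h with h5 | h5 <;> linarith

/-- `levelPiece k h` and its complement are both nondecreasing. -/
lemma levelPiece_sub_mul_nonneg (k h a b : ℝ) :
    0 ≤ (levelPiece k h a - levelPiece k h b) *
      ((a - levelPiece k h a) - (b - levelPiece k h b)) := by
  rcases le_total a b with hab | hab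
  · have h1 := levelPiece_mono (k := k) (h := h) hab
    have h2 := levelPiece_sub_le (k := k) (h := h) hab
    exact mul_nonneg_of_nonpos_of_nonpos (by linarith) (by linarith)
  · have h1 := levelPiece_mono (k := k) (h := h) hab
    have h2 := levelPiece_sub_le (k := k) (h := h) hab
    exact mul_nonneg (by linarith) (by linarith)

section
variable {𝕜 : Type*} [RCLike 𝕜]

lemma norm_radialTrunc {k h : ℝ} (hk : 0 ≤ k) (hh : 0 ≤ h) (z : 𝕜) :
    ‖radialTrunc k h z‖ = levelPiece k h ‖z‖ := by
  rcases eq_or_ne z 0 with rfl | hz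
  · simp [radialTrunc, levelPiece_of_le hh hk]
  · have : ‖z‖ ≠ 0 := norm_ne_zero_iff.2 hz
    rw [radialTrunc, norm_mul, RCLike.norm_ofReal,
      abs_of_nonneg (div_nonneg (levelPiece_nonneg hh _) (norm_nonneg _)),
      div_mul_cancel₀ _ this]

/-- The radial truncation is firmly nonexpansive. -/
lemma norm_radialTrunc_sub_sq_le {k h : ℝ} (hk : 0 ≤ k) (hh : 0 ≤ h) (z w : 𝕜) :
    ‖radialTrunc k h z - radialTrunc k h w‖ ^ 2 ≤
      RCLike.re ((z - w) * (starRingEnd 𝕜) (radialTrunc k h z - radialTrunc k h w)) := by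
  have key := levelPiece_sub_mul_nonneg k h ‖z‖ ‖w‖
  have hz : levelPiece k h ‖z‖ / ‖z‖ * ‖z‖ = levelPiece k h ‖z‖ := by
    rcases eq_or_ne ‖z‖ 0 with h0 | h0
    · rw [h0, levelPiece_of_le hh hk]; simp
    · exact div_mul_cancel₀ _ h0
  have hw : levelPiece k h ‖w‖ / ‖w‖ * ‖w‖ = levelPiece k h ‖w‖ := by
    rcases eq_or_ne ‖w‖ 0 with h0 | h0
    · rw [h0, levelPiece_of_le hh hk]; simp
    · exact div_mul_cancel₀ _ h0
  have hα0 : 0 ≤ levelPiece k h ‖z‖ / ‖z‖ :=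
    div_nonneg (levelPiece_nonneg hh _) (norm_nonneg _)
  have hβ0 : 0 ≤ levelPiece k h ‖w‖ / ‖w‖ :=
    div_nonneg (levelPiece_nonneg hh _) (norm_nonneg _)
  have hα1 : levelPiece k h ‖z‖ / ‖z‖ ≤ 1 :=
    div_le_one_of_le₀ (levelPiece_le hk (norm_nonneg _)) (norm_nonneg _)
  have hβ1 : levelPiece k h ‖w‖ / ‖w‖ ≤ 1 :=
    div_le_one_of_le₀ (levelPiece_le hk (norm_nonneg _)) (norm_nonneg _)
  unfold radialTrunc
  rw [← hz, ← hw] at key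
  generalize levelPiece k h ‖z‖ / ‖z‖ = α at *
  generalize levelPiece k h ‖w‖ / ‖w‖ = β at *
  have hc : RCLike.re z * RCLike.re w + RCLike.im z * RCLike.im w ≤ ‖z‖ * ‖w‖ := by
    have := RCLike.re_le_norm (z * (starRingEnd 𝕜) w)
    simpa [RCLike.mul_re] using this
  have h1 := RCLike.norm_sq_eq_def (z := z)
  have h2 := RCLike.norm_sq_eq_def (z := w)
  rw [RCLike.norm_sq_eq_def]
  simp only [map_sub, RCLike.mul_re, RCLike.mul_im, RCLike.ofReal_re, RCLike.ofReal_im,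
    RCLike.conj_re, RCLike.conj_im, map_mul]
  -- the difference of the two sides is affine and nonincreasing in `Re (z * conj w) ≤ ‖z‖ * ‖w‖`
  have h3 : 0 ≤ (α * (1 - β) + β * (1 - α)) *
      (‖z‖ * ‖w‖ - (RCLike.re z * RCLike.re w + RCLike.im z * RCLike.im w)) :=
    mul_nonneg (add_nonneg (mul_nonneg hα0 (by linarith)) (mul_nonneg hβ0 (by linarith)))
      (by linarith)
  have h4 : 0 ≤ α * (1 - α) * ‖z‖ ^ 2 + β * (1 - β) * ‖w‖ ^ 2
      - (α * (1 - β) + β * (1 - α)) * (‖z‖ * ‖w‖) := by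
    calc 0 ≤ _ := key
      _ = _ := by ring
  rw [h1, h2] at h4
  linarith

lemma norm_radialTrunc_sub_le {k h : ℝ} (hk : 0 ≤ k) (hh : 0 ≤ h) (z w : 𝕜) :
    ‖radialTrunc k h z - radialTrunc k h w‖ ≤ ‖z - w‖ := by
  have h1 := norm_radialTrunc_sub_sq_le hk hh z w
  have h2 := RCLike.re_le_norm
    ((z - w) * (starRingEnd 𝕜) (radialTrunc k h z - radialTrunc k h w))
  rw [norm_mul, RCLike.norm_conj] at h2
  by_contra! hlt
  nlinarith [norm_nonneg (z - w)]

lemma continuous_radialTrunc {k h : ℝ} (hk : 0 ≤ k) (hh : 0 ≤ h) :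
    Continuous (radialTrunc k h : 𝕜 → 𝕜) := by
  refine (LipschitzWith.of_dist_le_mul (K := 1) fun z w => ?_).continuous
  simpa [dist_eq_norm] using norm_radialTrunc_sub_le hk hh z w

end

/-! ### The Stampacchia iteration -/

/-- Stampacchia's lemma: a nonincreasing function with superlinear decay from level to level
vanishes at a finite level. -/
lemma exists_eq_zero_of_mul_le_rpow {a : ℝ → ℝ} (ha0 : ∀ k, 0 ≤ a k) (ha : Antitone a)
    {C ε : ℝ} (hC : 0 ≤ C) (hε : 0 < ε)
    (H : ∀ k h, 0 ≤ k → 0 < h → h * a (k + h) ≤ C * a k ^ (1 + ε)) :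
    ∃ d, 0 ≤ d ∧ a d = 0 := by
  -- with this `d` the bound `a (d (1 - 2 ^ (-j))) ≤ a 0 * 2 ^ (-j / ε)` propagates
  set q : ℝ := (2 : ℝ) ^ (-(1 / ε)) with hq
  have hq0 : 0 < q := by positivity
  have hq1 : q < 1 := Real.rpow_lt_one_of_one_lt_of_neg one_lt_two (by simpa using hε)
  have hqε : q ^ ε = 1 / 2 := by
    rw [hq, ← Real.rpow_mul (by norm_num), neg_mul, one_div_mul_cancel hε.ne',
      Real.rpow_neg_one, one_div]
  set d : ℝ := 2 * C * a 0 ^ ε / q + 1 with hd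
  have hd0 : 0 < d := by have := Real.rpow_nonneg (ha0 0) ε; positivity
  have hdC : 2 * C * a 0 ^ ε ≤ q * d := by
    rw [hd, mul_add, mul_div_cancel₀ _ hq0.ne']; linarith
  have step : ∀ j : ℕ, a (d * (1 - (1 / 2) ^ j)) ≤ a 0 * q ^ j := by
    intro j
    induction j with
    | zero => simp
    | succ j ih =>
      have hk : (0 : ℝ) ≤ d * (1 - (1 / 2) ^ j) :=
        mul_nonneg hd0.le (sub_nonneg.2 (pow_le_one₀ (by norm_num) (by norm_num)))
      have hh : (0 : ℝ) < d * (1 / 2) ^ (j + 1) := by positivity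
      have h1 := H _ _ hk hh
      rw [show d * (1 - (1 / 2) ^ j) + d * (1 / 2) ^ (j + 1) = d * (1 - (1 / 2 : ℝ) ^ (j + 1)) by
        ring] at h1
      have h2 : a (d * (1 - (1 / 2) ^ j)) ^ (1 + ε) ≤ a 0 * a 0 ^ ε * (q ^ j * (1 / 2) ^ j) := by
        calc a (d * (1 - (1 / 2) ^ j)) ^ (1 + ε)
            ≤ (a 0 * q ^ j) ^ (1 + ε) := Real.rpow_le_rpow (ha0 _) ih (by linarith)
          _ = a 0 ^ (1 + ε) * (q ^ j) ^ (1 + ε) := Real.mul_rpow (ha0 _) (by positivity)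
          _ = a 0 * a 0 ^ ε * (q ^ j * (1 / 2) ^ j) := by
            rw [Real.rpow_one_add' (ha0 _) (by linarith),
              Real.rpow_one_add' (by positivity) (by linarith), ← hqε,
              ← Real.rpow_natCast (q ^ ε), ← Real.rpow_mul hq0.le, ← Real.rpow_natCast q j,
              ← Real.rpow_mul hq0.le, mul_comm (j : ℝ) ε]
      have h3 : d * (1 / 2) ^ (j + 1) * a (d * (1 - (1 / 2) ^ (j + 1))) ≤
          d * (1 / 2) ^ (j + 1) * (a 0 * q ^ (j + 1)) := by
        calc _ ≤ C * (a 0 * a 0 ^ ε * (q ^ j * (1 / 2) ^ j)) :=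
              h1.trans (mul_le_mul_of_nonneg_left h2 hC)
          _ = (2 * C * a 0 ^ ε) * (a 0 * q ^ j * (1 / 2) ^ (j + 1)) := by ring
          _ ≤ (q * d) * (a 0 * q ^ j * (1 / 2) ^ (j + 1)) :=
              mul_le_mul_of_nonneg_right hdC (by have := ha0 0; positivity)
          _ = _ := by ring
      exact le_of_mul_le_mul_left h3 hh
  refine ⟨d, hd0.le, le_antisymm ?_ (ha0 d)⟩
  have hlim : Filter.Tendsto (fun j : ℕ => a 0 * q ^ j) Filter.atTop (nhds (a 0 * 0)) :=
    (tendsto_pow_atTop_nhds_zero_of_lt_one hq0.le hq1).const_mul _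
  rw [mul_zero] at hlim
  refine ge_of_tendsto' hlim fun j => (ha ?_).trans (step j)
  have : (0 : ℝ) ≤ (1 / 2) ^ j := by positivity
  nlinarith

/-! ### Boundedness from a decay estimate between level sets -/

section
variable {X E : Type*} [MeasurableSpace X] [NormedAddCommGroup E] {ν : Measure X}

lemma exists_setIntegral_norm_le_mul_rpow [IsFiniteMeasure ν] {f : X → E} {p : ℝ} (hp : 1 ≤ p)
    (hf : MemLp f (ENNReal.ofReal p) ν) :
    ∃ F, 0 ≤ F ∧ ∀ A : Set X, ∫ x in A, ‖f x‖ ∂ν ≤ F * ν.real A ^ (1 - 1 / p) := by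
  refine ⟨(eLpNorm f (ENNReal.ofReal p) ν).toReal, ENNReal.toReal_nonneg, fun A => ?_⟩
  have h1 : (1 : ℝ≥0∞) ≤ ENNReal.ofReal p := by simpa using hp
  have h2 := eLpNorm_le_eLpNorm_mul_rpow_measure_univ (μ := ν.restrict A) h1 hf.1.restrict
  have h0 : 0 ≤ 1 - 1 / p := sub_nonneg.2 ((div_le_one (by linarith)).2 hp)
  rw [Measure.restrict_apply_univ, ENNReal.toReal_one, ENNReal.toReal_ofReal (by linarith),
    div_one] at h2
  rw [integral_norm_eq_lintegral_enorm hf.1.restrict, ← eLpNorm_one_eq_lintegral_enorm,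
    measureReal_def, ENNReal.toReal_rpow, ← ENNReal.toReal_mul]
  refine ENNReal.toReal_mono (ENNReal.mul_ne_top hf.2.ne
    (ENNReal.rpow_ne_top_of_nonneg h0 (measure_ne_top _ _))) (h2.trans ?_)
  gcongr
  exact Measure.restrict_le_self

lemma measureReal_lt_norm_antitone [IsFiniteMeasure ν] (u : X → E) :
    Antitone fun k : ℝ => ν.real {x | k < ‖u x‖} := fun _ _ h =>
  measureReal_mono fun _ hx => lt_of_le_of_lt h hx

/-- Weak-type decay of the distribution function of exponent `β` puts `u` in `L^q` for `q < β`. -/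
lemma memLp_of_measureReal_lt_norm_le [IsFiniteMeasure ν] {u : X → E}
    (hu : AEStronglyMeasurable u ν) {D β q t₀ : ℝ} (hq : 0 < q) (hqβ : q < β) (ht₀ : 0 < t₀)
    (H : ∀ t, t₀ < t → ν.real {x | t < ‖u x‖} ≤ D * t ^ (-β)) :
    MemLp u (ENNReal.ofReal q) ν := by
  refine ⟨hu, ?_⟩
  rw [eLpNorm_lt_top_iff_lintegral_rpow_enorm_lt_top (by simpa using hq) ENNReal.ofReal_ne_top,
    ENNReal.toReal_ofReal hq.le]
  have e1 : ∫⁻ x, ‖u x‖ₑ ^ q ∂ν = ∫⁻ x, ENNReal.ofReal (‖u x‖ ^ q) ∂ν := by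
    refine lintegral_congr fun x => ?_
    rw [← ofReal_norm, ENNReal.ofReal_rpow_of_nonneg (norm_nonneg _) hq.le]
  rw [e1, lintegral_rpow_eq_lintegral_meas_lt_mul ν (Filter.Eventually.of_forall fun x =>
    norm_nonneg _) hu.norm.aemeasurable hq]
  refine ENNReal.mul_lt_top ENNReal.ofReal_lt_top ?_
  rw [← Set.Ioc_union_Ioi_eq_Ioi ht₀.le, lintegral_union measurableSet_Ioi (by
    rw [Set.disjoint_left]; intro x hx hx'; exact absurd hx.2 (not_le.2 hx'))]
  refine ENNReal.add_lt_top.2 ⟨?_, ?_⟩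
  · have hint : IntegrableOn (fun t : ℝ => ν.real Set.univ * t ^ (q - 1)) (Set.Ioc 0 t₀) := by
      refine Integrable.const_mul ?_ _
      have := (intervalIntegral.intervalIntegrable_rpow' (a := 0) (b := t₀) (r := q - 1)
        (by linarith))
      rwa [intervalIntegrable_iff_integrableOn_Ioc_of_le ht₀.le] at this
    refine lt_of_le_of_lt (setLIntegral_mono' measurableSet_Ioc fun t _ => ?_)
      hint.lintegral_lt_top
    rw [ENNReal.ofReal_mul measureReal_nonneg, ofReal_measureReal]
    gcongr
    exact Set.subset_univ _
  · have hint : IntegrableOn (fun t : ℝ => D * t ^ (q - 1 - β)) (Set.Ioi t₀) :=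
      (integrableOn_Ioi_rpow_of_lt (by linarith) ht₀).const_mul _
    refine lt_of_le_of_lt (setLIntegral_mono' measurableSet_Ioi fun t ht => ?_)
      hint.lintegral_lt_top
    have ht0 : 0 < t := ht₀.trans ht
    rw [← ofReal_measureReal, ← ENNReal.ofReal_mul measureReal_nonneg]
    refine ENNReal.ofReal_le_ofReal ((mul_le_mul_of_nonneg_right (H t ht)
      (by positivity)).trans_eq ?_)
    rw [mul_assoc, ← Real.rpow_add ht0]
    ring_nf

/-- `A_k = {‖u‖ > k}` satisfies the Chebyshev bounds `ν A_k ≤ I k^{-r}` and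
`∫_{A_k} ‖u‖ ≤ I k^{1-r}` with `I = ∫ ‖u‖^r`. -/
lemma setIntegral_norm_le_rpow [IsFiniteMeasure ν] {u : X → E} {r : ℝ} (hr : 1 ≤ r)
    (hu : MemLp u (ENNReal.ofReal r) ν) {k : ℝ} (hk : 0 < k) :
    ν.real {x | k < ‖u x‖} ≤ (∫ x, ‖u x‖ ^ r ∂ν) * k ^ (-r) ∧
    ∫ x in {x | k < ‖u x‖}, ‖u x‖ ∂ν ≤ (∫ x, ‖u x‖ ^ r ∂ν) * k ^ (1 - r) := by
  have hr0 : 0 < r := by linarith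
  have hint : Integrable (fun x => ‖u x‖ ^ r) ν := by
    have := hu.integrable_norm_rpow (by simpa using hr0) ENNReal.ofReal_ne_top
    rwa [ENNReal.toReal_ofReal hr0.le] at this
  have hA : NullMeasurableSet {x | k < ‖u x‖} ν :=
    nullMeasurableSet_lt aemeasurable_const hu.1.norm.aemeasurable
  constructor
  · rw [Real.rpow_neg hk.le, ← div_eq_mul_inv, le_div_iff₀ (by positivity), mul_comm]
    refine le_trans ?_ (mul_meas_ge_le_integral_of_nonneg
      (Filter.Eventually.of_forall fun x => by positivity) hint (k ^ r))
    refine mul_le_mul_of_nonneg_left (measureReal_mono fun x hx => ?_) (by positivity)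
    exact Real.rpow_le_rpow hk.le (le_of_lt hx) hr0.le
  · rw [← integral_mul_const]
    have hint' := hint.mul_const (k ^ (1 - r))
    refine le_trans ?_ (setIntegral_le_integral (s := {x | k < ‖u x‖}) hint'
      (Filter.Eventually.of_forall fun x => by positivity))
    have hui : Integrable u ν := hu.integrable (by simpa using hr)
    refine integral_mono_ae hui.norm.restrict hint'.restrict ?_
    filter_upwards [ae_restrict_mem₀ hA] with x hx
    have hx0 : 0 < ‖u x‖ := hk.trans hx
    calc ‖u x‖ = ‖u x‖ ^ r * ‖u x‖ ^ (1 - r) := by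
          rw [← Real.rpow_add hx0]; simp
      _ ≤ ‖u x‖ ^ r * k ^ (1 - r) := by
          refine mul_le_mul_of_nonneg_left ?_ (by positivity)
          exact Real.rpow_le_rpow_of_nonpos hk (le_of_lt hx) (by linarith)

variable {F : Type*} [NormedAddCommGroup F]

/-- One step of the bootstrap: the level estimate improves the integrability exponent of `u` by a
fixed factor larger than `1`. -/
lemma MemLp.exponent_improve_of_level_estimate [IsFiniteMeasure ν] {u : X → E} {f : X → F}
    {p σ C M r : ℝ} (hp : 1 ≤ p) (hpσ : 1 / p < σ) (hC : 0 ≤ C) (hM : 0 ≤ M) (hr : 1 ≤ r)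
    (hf : MemLp f (ENNReal.ofReal p) ν) (hu : MemLp u (ENNReal.ofReal r) ν)
    (H : ∀ k h, 0 ≤ k → 0 < h → h * ν.real {x | k + h < ‖u x‖} ≤
      C * ν.real {x | k < ‖u x‖} ^ σ *
        (∫ x in {x | k < ‖u x‖}, ‖f x‖ ∂ν + M * ∫ x in {x | k < ‖u x‖}, ‖u x‖ ∂ν)) :
    MemLp u (ENNReal.ofReal (r * (1 + (σ - 1 / p) / 2))) ν := by
  obtain ⟨Φ, hΦ, hΦf⟩ := exists_setIntegral_norm_le_mul_rpow hp hf
  have hp0 : 0 < 1 / p := by positivity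
  have hp1 : 1 / p ≤ 1 := (div_le_one (by linarith)).2 hp
  set ε := σ - 1 / p with hε
  have hε0 : 0 < ε := by linarith
  have hr0 : 0 < r := by linarith
  have hσ0 : 0 ≤ σ := by linarith
  set I := ∫ x, ‖u x‖ ^ r ∂ν with hI
  have hI0 : 0 ≤ I := integral_nonneg fun x => by positivity
  set D := C * (I ^ (1 + ε) * Φ + M * (I ^ σ * I)) with hD
  have key : ∀ k : ℝ, 1 ≤ k → ν.real {x | k + k < ‖u x‖} ≤ D * k ^ (-(r * (1 + ε))) := by
    intro k hk
    have hk0 : 0 < k := by linarith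
    obtain ⟨h1, h2⟩ := setIntegral_norm_le_rpow hr hu hk0
    have h3 := H k k hk0.le hk0
    have h4 := hΦf {x | k < ‖u x‖}
    set a := ν.real {x | k < ‖u x‖} with ha
    have ha0 : 0 ≤ a := measureReal_nonneg
    have e1 : a ^ σ * ∫ x in {x | k < ‖u x‖}, ‖f x‖ ∂ν ≤
        k * (I ^ (1 + ε) * Φ * k ^ (-(r * (1 + ε)))) := by
      calc a ^ σ * ∫ x in {x | k < ‖u x‖}, ‖f x‖ ∂ν ≤ a ^ σ * (Φ * a ^ (1 - 1 / p)) := by gcongr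
        _ = Φ * a ^ (1 + ε) := by
          rw [mul_left_comm, ← Real.rpow_add_of_nonneg ha0 (by linarith) (by linarith), hε]
          ring_nf
        _ ≤ Φ * (I * k ^ (-r)) ^ (1 + ε) := by gcongr
        _ = 1 * (I ^ (1 + ε) * Φ * k ^ (-(r * (1 + ε)))) := by
          rw [Real.mul_rpow hI0 (by positivity), ← Real.rpow_mul hk0.le, neg_mul]; ring
        _ ≤ _ := by gcongr
    have e2 : a ^ σ * ∫ x in {x | k < ‖u x‖}, ‖u x‖ ∂ν ≤
        k * ((I ^ σ * I) * k ^ (-(r * (1 + ε)))) := by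
      calc a ^ σ * ∫ x in {x | k < ‖u x‖}, ‖u x‖ ∂ν
          ≤ (I * k ^ (-r)) ^ σ * (I * k ^ (1 - r)) := by gcongr
        _ = k * ((I ^ σ * I) * k ^ (-(r * (1 + σ)))) := by
          rw [Real.mul_rpow hI0 (by positivity), ← Real.rpow_mul hk0.le,
            show k ^ (1 - r) = k * k ^ (-r) by
              rw [sub_eq_add_neg, Real.rpow_add hk0, Real.rpow_one],
            show -(r * (1 + σ)) = -r * σ + -r by ring, Real.rpow_add hk0]
          ring
        _ ≤ _ := by
          have hεσ : ε ≤ σ := by linarith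
          gcongr
    have h5 : k * ν.real {x | k + k < ‖u x‖} ≤ k * (D * k ^ (-(r * (1 + ε)))) := by
      calc _ ≤ _ := h3
        _ = C * (a ^ σ * (∫ x in {x | k < ‖u x‖}, ‖f x‖ ∂ν) +
              M * (a ^ σ * ∫ x in {x | k < ‖u x‖}, ‖u x‖ ∂ν)) := by ring
        _ ≤ C * (k * (I ^ (1 + ε) * Φ * k ^ (-(r * (1 + ε)))) +
              M * (k * ((I ^ σ * I) * k ^ (-(r * (1 + ε)))))) := by gcongr
        _ = _ := by rw [hD]; ring
    exact le_of_mul_le_mul_left h5 hk0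
  refine memLp_of_measureReal_lt_norm_le (D := D * (1 / 2) ^ (-(r * (1 + ε))))
    (β := r * (1 + ε)) (t₀ := 2) hu.1 (by positivity) (by nlinarith) two_pos fun t ht => ?_
  have h := key (t * (1 / 2)) (by linarith)
  rw [Real.mul_rpow (by linarith) (by norm_num)] at h
  rw [show t * (1 / 2) + t * (1 / 2) = t by ring] at h
  linarith

/-- If the level sets `A_k = {‖u‖ > k}` of `u ∈ L²` satisfy
`h |A_{k+h}| ≤ C |A_k|^σ (∫_{A_k} ‖f‖ + M ∫_{A_k} ‖u‖)` with `f ∈ L^p` and `σ > 1 / p`, then `u` is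
bounded. -/
lemma memLp_top_of_level_estimate [IsFiniteMeasure ν] {u : X → E} {f : X → F}
    {p σ C M : ℝ} (hp : 1 ≤ p) (hpσ : 1 / p < σ) (hC : 0 ≤ C) (hM : 0 ≤ M)
    (hf : MemLp f (ENNReal.ofReal p) ν) (hu : MemLp u 2 ν)
    (H : ∀ k h, 0 ≤ k → 0 < h → h * ν.real {x | k + h < ‖u x‖} ≤
      C * ν.real {x | k < ‖u x‖} ^ σ *
        (∫ x in {x | k < ‖u x‖}, ‖f x‖ ∂ν + M * ∫ x in {x | k < ‖u x‖}, ‖u x‖ ∂ν)) :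
    MemLp u ∞ ν := by
  have hp1 : 1 / p ≤ 1 := (div_le_one (by linarith)).2 hp
  have hε0 : 0 < σ - 1 / p := by linarith
  have hiter : ∀ N : ℕ, MemLp u (ENNReal.ofReal (2 * (1 + (σ - 1 / p) / 2) ^ N)) ν := by
    intro N
    induction N with
    | zero => simpa using hu
    | succ N ih =>
      rw [pow_succ, ← mul_assoc]
      refine MemLp.exponent_improve_of_level_estimate hp hpσ hC hM ?_ hf ih H
      have : (1 : ℝ) ≤ (1 + (σ - 1 / p) / 2) ^ N := one_le_pow₀ (by linarith)
      linarith
  have hup : MemLp u (ENNReal.ofReal p) ν := by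
    obtain ⟨N, hN⟩ := pow_unbounded_of_one_lt p (show 1 < 1 + (σ - 1 / p) / 2 by linarith)
    exact (hiter N).mono_exponent (ENNReal.ofReal_le_ofReal (by linarith))
  obtain ⟨Φ, hΦ, hΦf⟩ := exists_setIntegral_norm_le_mul_rpow hp hf
  obtain ⟨U, hU, hUu⟩ := exists_setIntegral_norm_le_mul_rpow hp hup
  obtain ⟨d, hd, hd0⟩ := exists_eq_zero_of_mul_le_rpow (a := fun k => ν.real {x | k < ‖u x‖})
    (C := C * (Φ + M * U)) (ε := σ - 1 / p) (fun k => measureReal_nonneg)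
    (measureReal_lt_norm_antitone u) (by positivity) hε0 (by
      intro k h hk hh
      have h1 := hΦf {x | k < ‖u x‖}
      have h2 := hUu {x | k < ‖u x‖}
      refine (H k h hk hh).trans ?_
      have ha0 : 0 ≤ ν.real {x | k < ‖u x‖} := measureReal_nonneg
      calc _ ≤ C * ν.real {x | k < ‖u x‖} ^ σ * (Φ * ν.real {x | k < ‖u x‖} ^ (1 - 1 / p) +
            M * (U * ν.real {x | k < ‖u x‖} ^ (1 - 1 / p))) := by gcongr
        _ = C * (Φ + M * U) *
            (ν.real {x | k < ‖u x‖} ^ σ * ν.real {x | k < ‖u x‖} ^ (1 - 1 / p)) := by ring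
        _ = _ := by
          have : 0 < 1 / p := by positivity
          rw [← Real.rpow_add_of_nonneg ha0 (by linarith) (by linarith)]
          ring_nf)
  refine memLp_top_of_bound hu.1 d ?_
  rw [ae_iff]
  simpa only [not_le] using (measureReal_eq_zero_iff).1 hd0

end

/-! ### A fractional Faber–Krahn inequality -/

section
variable {𝕜 : Type*} [RCLike 𝕜] {n : ℕ} {s : ℝ}

/-- The Gagliardo energy of `v` controls its `L²` norm with a constant that depends only on the
volume of a set `A` carrying `v`: a ball around `x ∈ A` of volume `2 |A|` contains a set of volume
`|A|` on which `v` vanishes. -/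
lemma exists_integral_norm_sq_le_energy (hn : 1 ≤ n) (hs : 0 < s) :
    ∃ c : ℝ, 0 ≤ c ∧ ∀ (v : EuclideanSpace ℝ (Fin n) → 𝕜) (A : Set (EuclideanSpace ℝ (Fin n))),
      MemHs s v → volume A ≠ ∞ → (∀ x, x ∉ A → v x = 0) →
      ∫ x, ‖v x‖ ^ 2 ≤ c * volume.real A ^ (2 * s / n) *
        ∫ z : EuclideanSpace ℝ (Fin n) × EuclideanSpace ℝ (Fin n),
          ‖v z.1 - v z.2‖ ^ 2 / ‖z.1 - z.2‖ ^ ((n : ℝ) + 2 * s) ∂(volume.prod volume) := by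
  have : NeZero n := ⟨by omega⟩
  have hn0 : (0 : ℝ) < n := by exact_mod_cast hn
  set ω : ℝ := volume.real (Metric.ball (0 : EuclideanSpace ℝ (Fin n)) 1) with hω
  have hω0 : 0 < ω := ENNReal.toReal_pos (Metric.measure_ball_pos _ _ one_pos).ne'
    measure_ball_lt_top.ne
  refine ⟨(2 / ω) ^ (1 + 2 * s / n), by positivity, fun v A hv hA hvA => ?_⟩
  set a := volume.real A with ha
  have hE0 : 0 ≤ ∫ z : EuclideanSpace ℝ (Fin n) × EuclideanSpace ℝ (Fin n),
          ‖v z.1 - v z.2‖ ^ 2 / ‖z.1 - z.2‖ ^ ((n : ℝ) + 2 * s) ∂(volume.prod volume) :=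
    integral_nonneg fun z => by positivity
  rcases (measureReal_nonneg (μ := volume) (s := A)).eq_or_lt with h0 | ha0
  · have hA0 : volume A = 0 := (measureReal_eq_zero_iff hA).1 h0.symm
    have : ∫ x, ‖v x‖ ^ 2 = 0 := by
      rw [← integral_zero (EuclideanSpace ℝ (Fin n)) ℝ (μ := volume)]
      refine integral_congr_ae ?_
      filter_upwards [measure_eq_zero_iff_ae_notMem.1 hA0] with x hx
      simp [hvA x hx]
    rw [this]
    have : 0 ≤ a := h0.le
    positivity
  replace ha0 : 0 < a := ha0
  set R : ℝ := (2 * a / ω) ^ (1 / (n : ℝ)) with hR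
  have hR0 : 0 < R := by positivity
  have hball : ∀ x : EuclideanSpace ℝ (Fin n),
      volume (Metric.ball x R) = ENNReal.ofReal (2 * a) := by
    intro x
    rw [Measure.addHaar_ball _ _ hR0.le, finrank_euclideanSpace, Fintype.card_fin,
      ← ofReal_measureReal (measure_ball_lt_top.ne), ← hω, ← ENNReal.ofReal_mul (by positivity),
      hR, ← Real.rpow_natCast, ← Real.rpow_mul (by positivity), one_div_mul_cancel hn0.ne',
      Real.rpow_one, div_mul_cancel₀ _ hω0.ne']
  -- the zero set of `v` fills at least half of each of these balls
  have hhalf : ∀ x : EuclideanSpace ℝ (Fin n),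
      ENNReal.ofReal a ≤ volume (Metric.ball x R \ toMeasurable volume A) := by
    intro x
    refine le_trans ?_ le_measure_sdiff
    rw [hball, measure_toMeasurable, ← ofReal_measureReal hA, ← ENNReal.ofReal_sub _ ha0.le]
    exact ENNReal.ofReal_le_ofReal (by linarith)
  have hpt : ∀ x, ENNReal.ofReal (‖v x‖ ^ 2 * (a / R ^ ((n : ℝ) + 2 * s))) ≤
      ∫⁻ y, ENNReal.ofReal (‖v x - v y‖ ^ 2 / ‖x - y‖ ^ ((n : ℝ) + 2 * s)) := by
    intro x
    by_cases hx : v x = 0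
    · simp [hx]
    have hxA : x ∈ A := by by_contra h; exact hx (hvA x h)
    calc ENNReal.ofReal (‖v x‖ ^ 2 * (a / R ^ ((n : ℝ) + 2 * s)))
        = ENNReal.ofReal (‖v x‖ ^ 2 / R ^ ((n : ℝ) + 2 * s)) * ENNReal.ofReal a := by
          rw [← ENNReal.ofReal_mul (by positivity)]; ring_nf
      _ ≤ ENNReal.ofReal (‖v x‖ ^ 2 / R ^ ((n : ℝ) + 2 * s)) *
          volume (Metric.ball x R \ toMeasurable volume A) := by gcongr; exact hhalf x
      _ = ∫⁻ _ in Metric.ball x R \ toMeasurable volume A,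
          ENNReal.ofReal (‖v x‖ ^ 2 / R ^ ((n : ℝ) + 2 * s)) := (setLIntegral_const _ _).symm
      _ ≤ ∫⁻ y in Metric.ball x R \ toMeasurable volume A,
          ENNReal.ofReal (‖v x - v y‖ ^ 2 / ‖x - y‖ ^ ((n : ℝ) + 2 * s)) := by
          refine setLIntegral_mono' (measurableSet_ball.diff (measurableSet_toMeasurable _ _))
            fun y hy => ENNReal.ofReal_le_ofReal ?_
          have hyA : y ∉ A := fun h => hy.2 (subset_toMeasurable _ _ h)
          have hxy : 0 < ‖x - y‖ := norm_sub_pos_iff.2 fun h => hyA (h ▸ hxA)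
          have hyR : ‖x - y‖ ≤ R := by
            rw [← dist_eq_norm, dist_comm]; exact (Metric.mem_ball.1 hy.1).le
          rw [hvA y hyA, sub_zero]
          gcongr
      _ ≤ _ := setLIntegral_le_lintegral _ _
  have hint2 : Integrable (fun x => ‖v x‖ ^ 2 * (a / R ^ ((n : ℝ) + 2 * s))) volume :=
    (hv.1.integrable_norm_pow two_ne_zero).mul_const _
  have hmain : (∫ x, ‖v x‖ ^ 2) * (a / R ^ ((n : ℝ) + 2 * s)) ≤
      ∫ z : EuclideanSpace ℝ (Fin n) × EuclideanSpace ℝ (Fin n),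
          ‖v z.1 - v z.2‖ ^ 2 / ‖z.1 - z.2‖ ^ ((n : ℝ) + 2 * s) ∂(volume.prod volume) := by
    rw [← ENNReal.ofReal_le_ofReal_iff hE0, ← integral_mul_const,
      ofReal_integral_eq_lintegral_ofReal hint2
        (Filter.Eventually.of_forall fun x => by positivity),
      ofReal_integral_eq_lintegral_ofReal hv.2
        (Filter.Eventually.of_forall fun x => by positivity),
      lintegral_prod _ hv.2.1.aemeasurable.ennreal_ofReal]
    exact lintegral_mono hpt
  have hconst : (2 / ω) ^ (1 + 2 * s / n) * a ^ (2 * s / n) = R ^ ((n : ℝ) + 2 * s) / a := by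
    rw [hR, ← Real.rpow_mul (by positivity),
      show 1 / (n : ℝ) * ((n : ℝ) + 2 * s) = 1 + 2 * s / n by field_simp,
      show 2 * a / ω = 2 / ω * a by ring, Real.mul_rpow (by positivity) ha0.le,
      Real.rpow_add ha0 1, Real.rpow_one]
    field_simp
  rw [hconst]
  have hRp : 0 < R ^ ((n : ℝ) + 2 * s) := by positivity
  calc ∫ x, ‖v x‖ ^ 2 = R ^ ((n : ℝ) + 2 * s) / a *
        ((∫ x, ‖v x‖ ^ 2) * (a / R ^ ((n : ℝ) + 2 * s))) := by
        field_simp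
    _ ≤ _ := mul_le_mul_of_nonneg_left hmain (by positivity)

end

/-! ### The truncation as a test function -/

section
variable {𝕜 : Type*} [RCLike 𝕜] {n : ℕ} {s : ℝ}

lemma fracLaplacianConst_pos (n : ℕ) (hs0 : 0 < s) (hs1 : s < 1) :
    0 < fracLaplacianConst n s := by
  have h1 : 0 < Real.Gamma (((n : ℝ) + 2 * s) / 2) := Real.Gamma_pos_of_pos (by positivity)
  have h2 : 0 < Real.Gamma (1 - s) := Real.Gamma_pos_of_pos (by linarith)
  have := Real.pi_pos
  unfold fracLaplacianConst
  positivity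

lemma MemHsZero.radialTrunc {Ω : Set (EuclideanSpace ℝ (Fin n))}
    {u : EuclideanSpace ℝ (Fin n) → 𝕜} (hu : MemHsZero s Ω u) {k h : ℝ} (hk : 0 ≤ k)
    (hh : 0 ≤ h) : MemHsZero s Ω (fun x => radialTrunc k h (u x)) := by
  have hm : AEStronglyMeasurable (fun x => _root_.radialTrunc k h (u x)) volume :=
    (continuous_radialTrunc hk hh).comp_aestronglyMeasurable hu.1.1.1
  refine ⟨⟨hu.1.1.mono hm (Filter.Eventually.of_forall fun x => ?_), ?_⟩, ?_⟩
  · rw [norm_radialTrunc hk hh]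
    exact levelPiece_le hk (norm_nonneg _)
  · refine hu.1.2.mono ?_ (Filter.Eventually.of_forall fun z => ?_)
    · refine ((((hm.comp_fst).sub (hm.comp_snd)).norm.pow 2).aemeasurable.div
        (Measurable.aemeasurable ?_)).aestronglyMeasurable
      fun_prop
    · rw [Real.norm_of_nonneg (by positivity), Real.norm_of_nonneg (by positivity)]
      gcongr
      exact norm_radialTrunc_sub_le hk hh _ _
  · filter_upwards [hu.2] with x hx hxΩ
    simp [_root_.radialTrunc, hx hxΩ]

/-- Testing with the truncation of `u` bounds the energy of that truncation. -/
lemma energy_radialTrunc_le_re_fracLaplacianForm {Ω : Set (EuclideanSpace ℝ (Fin n))}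
    {u : EuclideanSpace ℝ (Fin n) → 𝕜} (hu : MemHsZero s Ω u) (hs0 : 0 < s) (hs1 : s < 1)
    {k h : ℝ} (hk : 0 ≤ k) (hh : 0 ≤ h) :
    fracLaplacianConst n s / 2 *
      ∫ z : EuclideanSpace ℝ (Fin n) × EuclideanSpace ℝ (Fin n),
        ‖radialTrunc k h (u z.1) - radialTrunc k h (u z.2)‖ ^ 2 /
          ‖z.1 - z.2‖ ^ ((n : ℝ) + 2 * s) ∂(volume.prod volume) ≤
      RCLike.re (fracLaplacianForm s u (fun x => radialTrunc k h (u x))) := by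
  have hv := hu.radialTrunc hk hh
  have hint : Integrable (fun z : EuclideanSpace ℝ (Fin n) × EuclideanSpace ℝ (Fin n) =>
      (u z.1 - u z.2) * (starRingEnd 𝕜) (radialTrunc k h (u z.1) - radialTrunc k h (u z.2)) /
        ((‖z.1 - z.2‖ ^ ((n : ℝ) + 2 * s) : ℝ) : 𝕜)) (volume.prod volume) := by
    refine hu.1.2.mono ?_ (Filter.Eventually.of_forall fun z => ?_)
    · have h1 := (hu.1.1.1.comp_fst (ν := volume)).sub (hu.1.1.1.comp_snd (μ := volume))
      have h2 := (hv.1.1.1.comp_fst (ν := volume)).sub (hv.1.1.1.comp_snd (μ := volume))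
      have h3 : Measurable fun z : EuclideanSpace ℝ (Fin n) × EuclideanSpace ℝ (Fin n) =>
          ((‖z.1 - z.2‖ ^ ((n : ℝ) + 2 * s) : ℝ) : 𝕜) :=
        RCLike.measurable_ofReal.comp (by fun_prop)
      exact ((h1.mul (RCLike.continuous_conj.comp_aestronglyMeasurable h2)).aemeasurable.div
        h3.aemeasurable).aestronglyMeasurable
    · rw [norm_div, norm_mul, RCLike.norm_conj, RCLike.norm_ofReal, Real.norm_of_nonneg
        (by positivity), abs_of_nonneg (by positivity), sq]
      gcongr
      exact norm_radialTrunc_sub_le hk hh _ _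
  have hc := fracLaplacianConst_pos n hs0 hs1
  rw [fracLaplacianForm, RCLike.re_ofReal_mul, ← integral_re hint]
  refine mul_le_mul_of_nonneg_left (integral_mono hv.1.2 hint.re fun z => ?_) (by positivity)
  simp only [RCLike.div_re_ofReal]
  gcongr
  exact norm_radialTrunc_sub_sq_le hk hh _ _

lemma norm_integral_mul_conj_le {X : Type*} [MeasurableSpace X] {ν : Measure X} {g v : X → 𝕜}
    (hg : Integrable g ν) {A : Set X} (hA : NullMeasurableSet A ν) {h : ℝ}
    (hv : ∀ x, ‖v x‖ ≤ h) (hvA : ∀ x, x ∉ A → v x = 0) :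
    ‖∫ x, g x * (starRingEnd 𝕜) (v x) ∂ν‖ ≤ h * ∫ x in A, ‖g x‖ ∂ν := by
  rw [← integral_indicator₀ hA, ← integral_const_mul]
  refine norm_integral_le_of_norm_le ((hg.norm.indicator₀ hA).const_mul h)
    (Filter.Eventually.of_forall fun x => ?_)
  by_cases hx : x ∈ A
  · rw [Set.indicator_of_mem hx, norm_mul, RCLike.norm_conj, mul_comm]
    exact mul_le_mul_of_nonneg_right (hv x) (norm_nonneg _)
  · simp [hvA x hx, hx]

/-- The decay of the level sets of a weak solution: the truncation `v` of `u` between the levels `k`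
and `k + h` has norm `h` on `{‖u‖ > k + h}`, so `h² |{‖u‖ > k + h}| ≤ ‖v‖₂²`, and the right-hand
side of the equation tested with `v` is at most `h` times an integral over `{‖u‖ > k}`. -/
lemma exists_level_estimate (hn : 1 ≤ n) (hs0 : 0 < s) (hs1 : s < 1)
    {Ω : Set (EuclideanSpace ℝ (Fin n))} (hΩ : MeasurableSet Ω) (hΩf : volume Ω ≠ ∞)
    {μ : 𝕜} {f u : EuclideanSpace ℝ (Fin n) → 𝕜} (hf : Integrable f (volume.restrict Ω))
    (hu : IsFracWeakSolution s Ω μ f u) :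
    ∃ C, 0 ≤ C ∧ ∀ k h : ℝ, 0 ≤ k → 0 < h →
      h * (volume.restrict Ω).real {x | k + h < ‖u x‖} ≤
      C * (volume.restrict Ω).real {x | k < ‖u x‖} ^ (2 * s / n) *
        (∫ x in {x | k < ‖u x‖}, ‖f x‖ ∂(volume.restrict Ω) +
          ‖μ‖ * ∫ x in {x | k < ‖u x‖}, ‖u x‖ ∂(volume.restrict Ω)) := by
  obtain ⟨c, hc, hFK⟩ := exists_integral_norm_sq_le_energy (𝕜 := 𝕜) hn hs0
  have hK := fracLaplacianConst_pos n hs0 hs1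
  have : IsFiniteMeasure (volume.restrict Ω) := ⟨by simpa using hΩf.lt_top⟩
  have hu0 := hu.1.2
  have hui : Integrable u (volume.restrict Ω) :=
    (hu.1.1.1.restrict Ω).integrable one_le_two
  -- the level sets of `u` lie in `Ω` up to a null set
  have hvol : ∀ k : ℝ, 0 ≤ k →
      (volume.restrict Ω) {x | k < ‖u x‖} = volume {x | k < ‖u x‖} := by
    intro k hk
    rw [Measure.restrict_apply' hΩ]
    refine measure_congr ?_
    filter_upwards [hu0] with x hx
    refine propext ⟨fun h => h.1, fun h => ⟨h, ?_⟩⟩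
    by_contra hxΩ
    have h' : k < ‖u x‖ := h
    rw [hx hxΩ, norm_zero] at h'
    linarith
  have hnull : ∀ k : ℝ, NullMeasurableSet {x | k < ‖u x‖} volume := fun k =>
    nullMeasurableSet_lt aemeasurable_const hu.1.1.1.1.norm.aemeasurable
  refine ⟨c * (2 / fracLaplacianConst n s), by positivity, fun k h hk hh => ?_⟩
  have hvH := hu.1.radialTrunc hk hh.le
  have hvA : ∀ x, x ∉ {x | k < ‖u x‖} → radialTrunc k h (u x) = 0 := by
    intro x hx
    rw [← norm_eq_zero, norm_radialTrunc hk hh.le, levelPiece_of_le hh.le (not_lt.1 hx)]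
  have hvh : ∀ x, ‖radialTrunc k h (u x)‖ ≤ h := fun x => by
    rw [norm_radialTrunc hk hh.le]; exact levelPiece_le_height _ _ _
  have hfk := hFK _ _ hvH.1 (by rw [← hvol k hk]; exact measure_ne_top _ _) hvA
  have hlow : h * (h * (volume.restrict Ω).real {x | k + h < ‖u x‖}) ≤
      ∫ x, ‖radialTrunc k h (u x)‖ ^ 2 := by
    have hint := hvH.1.1.integrable_norm_pow two_ne_zero
    rw [measureReal_def, hvol _ (by linarith), ← measureReal_def, ← mul_assoc, ← sq]
    refine le_trans ?_ (mul_meas_ge_le_integral_of_nonneg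
      (Filter.Eventually.of_forall fun x => by positivity) hint (h ^ 2))
    refine mul_le_mul_of_nonneg_left ?_ (by positivity)
    refine measureReal_mono (fun x hx => ?_) ?_
    · simp only [Set.mem_ofPred_eq]
      rw [norm_radialTrunc hk hh.le, levelPiece_of_ge (le_of_lt hx)]
    · exact (hint.measure_ge_lt_top (by positivity)).ne
  have hen := energy_radialTrunc_le_re_fracLaplacianForm hu.1 hs0 hs1 hk hh.le
  have hweak := hu.2 _ hvH
  rw [sub_eq_iff_eq_add] at hweak
  have hre : RCLike.re (fracLaplacianForm s u (fun x => radialTrunc k h (u x))) ≤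
      h * (∫ x in {x | k < ‖u x‖}, ‖f x‖ ∂(volume.restrict Ω) +
          ‖μ‖ * ∫ x in {x | k < ‖u x‖}, ‖u x‖ ∂(volume.restrict Ω)) := by
    refine (RCLike.re_le_norm _).trans ?_
    rw [hweak]
    refine (norm_add_le _ _).trans ?_
    rw [norm_mul]
    have hA := (hnull k).mono_ac (Measure.restrict_le_self (s := Ω)).absolutelyContinuous
    have h1 := norm_integral_mul_conj_le hf hA hvh hvA
    have h2 := mul_le_mul_of_nonneg_left
      (norm_integral_mul_conj_le hui hA hvh hvA) (norm_nonneg μ)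
    linarith
  rw [show volume.real {x | k < ‖u x‖} = (volume.restrict Ω).real {x | k < ‖u x‖} by
    rw [measureReal_def, measureReal_def, hvol k hk]] at hfk
  set S := ∫ x in {x | k < ‖u x‖}, ‖f x‖ ∂(volume.restrict Ω) +
          ‖μ‖ * ∫ x in {x | k < ‖u x‖}, ‖u x‖ ∂(volume.restrict Ω)
  set a := (volume.restrict Ω).real {x | k < ‖u x‖}
  have ha : 0 ≤ a := measureReal_nonneg
  refine le_of_mul_le_mul_left (hlow.trans (hfk.trans ?_)) hh
  calc _ = c * a ^ (2 * s / n) * (2 / fracLaplacianConst n s) *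
        (fracLaplacianConst n s / 2 * ∫ z : EuclideanSpace ℝ (Fin n) × EuclideanSpace ℝ (Fin n),
          ‖radialTrunc k h (u z.1) - radialTrunc k h (u z.2)‖ ^ 2 /
          ‖z.1 - z.2‖ ^ ((n : ℝ) + 2 * s) ∂(volume.prod volume)) := by
        field_simp
    _ ≤ c * a ^ (2 * s / n) * (2 / fracLaplacianConst n s) * (h * S) :=
        mul_le_mul_of_nonneg_left (hen.trans hre) (by positivity)
    _ = _ := by ring

end

/-! ### Boundedness of solutions and eigenfunctions -/

theorem theoremA1 {𝕜 : Type*} [RCLike 𝕜] (n : ℕ) (hn : 1 ≤ n) (s : ℝ) (hs0 : 0 < s) (hs1 : s < 1)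
    (Ω : Set (EuclideanSpace ℝ (Fin n))) (hΩ : IsOpen Ω) (hΩb : Bornology.IsBounded Ω) :
    (∀ (p : ℝ≥0∞) (μ : 𝕜) (f u : EuclideanSpace ℝ (Fin n) → 𝕜),
      1 < p → ENNReal.ofReal ((n : ℝ) / (2 * s)) < p →
      MemLpAddLinfty p Ω f → IsFracWeakSolution s Ω μ f u →
      MemLp u ∞ (volume.restrict Ω)) ∧
    (∀ (μ : 𝕜) (u : EuclideanSpace ℝ (Fin n) → 𝕜),
      IsFracEigenfunction s Ω μ u → MemLp u ∞ (volume.restrict Ω)) := by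
  have hΩf : volume Ω ≠ ∞ := hΩb.measure_lt_top.ne
  have : IsFiniteMeasure (volume.restrict Ω) := ⟨by simpa using hΩf.lt_top⟩
  have hn0 : (0 : ℝ) < n := by exact_mod_cast hn
  have main : ∀ (p : ℝ≥0∞) (μ : 𝕜) (f u : EuclideanSpace ℝ (Fin n) → 𝕜),
      1 < p → ENNReal.ofReal ((n : ℝ) / (2 * s)) < p →
      MemLpAddLinfty p Ω f → IsFracWeakSolution s Ω μ f u →
      MemLp u ∞ (volume.restrict Ω) := by
    intro p μ f u hp1 hpn ⟨f₁, f₂, hf₁, hf₂, hf⟩ hu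
    -- on a set of finite measure `p` may be lowered to a finite exponent `q > max 1 (n / (2 s))`
    obtain ⟨q, hq, hqp⟩ := ENNReal.lt_iff_exists_nnreal_btwn.1 (max_lt hp1 hpn)
    have hq1 : (1 : ℝ) < q := by exact_mod_cast (le_max_left _ _).trans_lt hq
    have hqn : (n : ℝ) / (2 * s) < q := by
      have := (le_max_right _ _).trans_lt hq
      rw [← ENNReal.ofReal_coe_nnreal] at this
      exact (ENNReal.ofReal_lt_ofReal_iff (by linarith)).1 this
    have hfq : MemLp f (ENNReal.ofReal q) (volume.restrict Ω) := by
      rw [ENNReal.ofReal_coe_nnreal]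
      exact (memLp_congr_ae hf).2 ((hf₁.mono_exponent hqp.le).add (hf₂.mono_exponent le_top))
    obtain ⟨C, hC, H⟩ := exists_level_estimate hn hs0 hs1 hΩ.measurableSet hΩf
      (hfq.integrable (by simpa using hq1.le)) hu
    refine memLp_top_of_level_estimate hq1.le ?_ hC (norm_nonneg μ) hfq (hu.1.1.1.restrict Ω) H
    rw [div_lt_div_iff₀ (by linarith) hn0]
    rw [div_lt_iff₀ (by positivity)] at hqn
    linarith
  refine ⟨main, fun μ u hu => main ∞ μ 0 u ENNReal.one_lt_top ENNReal.ofReal_lt_top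
    ⟨0, 0, MemLp.zero, MemLp.zero, by simp⟩ ⟨hu.2.1, fun v hv => ?_⟩⟩
  rw [hu.2.2 v hv]
  simp
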